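/- Let $\mathcal A$ be a Grothendieck category. An object $M$ is \emph{finitely generated} if every family of subobjects of $M$ with sum $M$ has a finite subfamily with sum $M$, and \emph{finitely cogenerated} if every family of subobjects of $M$ with intersection $0$ has a finite subfamily with intersection $0$. A subobject $K$ of $L$ is \emph{essential} if $K\cap X=0$ implies $X=0$, and \emph{superfluous} if $K+X=L$ implies $X=L$, for every subobject $X$ of $L$. A monomorphism $f$ is \emph{essential} if every $h$ such that $hf$ is a monomorphism is itself a monomorphism, and an epimorphism $f$ is \emph{superfluous} if every $h$ such that $fh$ is an epimorphism is itself an epimorphism. An object $M$ is called \begin{itemize} \item \emph{self-CS-Rickart} if for every $f:M\to M$ there are an essential monomorphism $e:\mathrm{Ker}(f)\to L$ and a section (split monomorphism) $s:L\to M$ with $\ker(f)=se$; \emph{dual self-CS-Rickart} if for every $f:M\to M$ there are a retraction (split epimorphism) $r:M\to P$ and a superfluous epimorphism $t:P\to\mathrm{Coker}(f)$ with $\mathrm{coker}(f)=tr$; \item \emph{singular} if $M\cong L/K$ for some object $L$ and some essential subobject $K$ of $L$; \emph{small} if $M$ is isomorphic to a superfluous subobject of some object $L$; \item \emph{weakly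 hereditary} (respectively \emph{weakly semihereditary}) if every subobject (respectively every finitely generated subobject) of $M$ is the direct sum of a singular subobject and a projective subobject; \item \emph{weakly cohereditary} (respectively \emph{weakly semicohereditary}) if every factor object (respectively every finitely cogenerated factor object) of $M$ is the direct sum of a small subobject and an injective subobject. \end{itemize} (1) Assume that $\mathcal A$ has a (small) family of finitely generated projective generators. Then every projective object of $\mathcal A$ is weakly hereditary if and only if every projective object of $\mathcal A$ is self-CS-Rickart; and every finitely generated projective object of $\mathcal A$ is weakly semihereditary if and only if every finitely generated projective object of $\mathcal A$ is self-CS-Rickart. (2) Assume that $\mathcal A$ is locally finitely generated, that is, it has a (small) family of finitely generated generators. Then every injective object of $\mathcal A$ is weakly cohereditary if and only if every injective object of $\mathcal A$ is dual self-CS-Rickart; and every finitely cogenerated injective object of $\mathcal A$ is weakly semicohereditary if and only if every finitely cogenerated injective object of $\mathcal A$ is dual self-CS-Rickart. -/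

import Mathlib

open CategoryTheory CategoryTheory.Limits

universe w v u

namespace CSRickart

section Defs

variable {C : Type u} [Category.{v} C] [Abelian C]

/-- A monomorphism `f` is essential if `h` is a monomorphism whenever `h ∘ f` is. -/
def EssentialMono {M N : C} (f : M ⟶ N) : Prop :=
  Mono f ∧ ∀ ⦃P : C⦄ (h : N ⟶ P), Mono (f ≫ h) → Mono h

/-- An epimorphism `f` is superfluous if `h` is an epimorphism whenever `f ∘ h` is. -/
def SuperfluousEpi {M N : C} (f : M ⟶ N) : Prop :=
  Epi f ∧ ∀ ⦃P : C⦄ (h : P ⟶ M), Epi (h ≫ f) → Epi h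

/-- A subobject `K` of `L` is essential if `K ∩ X = 0` implies `X = 0`. -/
def EssentialSubobject {L : C} (K : Subobject L) : Prop :=
  ∀ X : Subobject L, K ⊓ X = ⊥ → X = ⊥

/-- A subobject `K` of `L` is superfluous if `K + X = L` implies `X = L`. -/
def SuperfluousSubobject {L : C} (K : Subobject L) : Prop :=
  ∀ X : Subobject L, K ⊔ X = ⊤ → X = ⊤

/-- `N` is `M`-CS-Rickart: the kernel of every `f : M ⟶ N` is an essential monomorphism
followed by a section. -/
def RelCSRickart (M N : C) : Prop :=
  ∀ f : M ⟶ N, ∃ (L : C) (e : kernel f ⟶ L) (s : L ⟶ M),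
    EssentialMono e ∧ IsSplitMono s ∧ e ≫ s = kernel.ι f

/-- `N` is dual `M`-CS-Rickart: the cokernel of every `f : M ⟶ N` is a retraction followed by a
superfluous epimorphism. -/
def DualRelCSRickart (M N : C) : Prop :=
  ∀ f : M ⟶ N, ∃ (P : C) (r : N ⟶ P) (t : P ⟶ cokernel f),
    IsSplitEpi r ∧ SuperfluousEpi t ∧ r ≫ t = cokernel.π f

def SelfCSRickart (M : C) : Prop := RelCSRickart M M

def DualSelfCSRickart (M : C) : Prop := DualRelCSRickart M M

/-- `M ≅ L / K` for some object `L` and some essential subobject `K` of `L`. -/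
def Singular (M : C) : Prop :=
  ∃ (L : C) (K : Subobject L), EssentialSubobject K ∧ Nonempty (M ≅ cokernel K.arrow)

/-- `M` is (isomorphic to) a superfluous subobject of some object `L`. -/
def SmallObj (M : C) : Prop :=
  ∃ (L : C) (K : Subobject L), SuperfluousSubobject K ∧ Nonempty (M ≅ (K : C))

/-- Every family of subobjects of `M` with sum `M` has a finite subfamily with sum `M`. -/
def FinGen (M : C) : Prop :=
  ∀ S : Set (Subobject M), IsLUB S ⊤ →
    ∃ t : Finset (Subobject M), (t : Set (Subobject M)) ⊆ S ∧ t.sup id = ⊤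

/-- Every family of subobjects of `M` with zero intersection has a finite subfamily with zero
intersection. -/
def FinCogen (M : C) : Prop :=
  ∀ S : Set (Subobject M), IsGLB S ⊥ →
    ∃ t : Finset (Subobject M), (t : Set (Subobject M)) ⊆ S ∧ t.inf id = ⊥

/-- Every subobject of `M` is the direct sum of a singular and a projective object. -/
def WeaklyHereditary (M : C) : Prop :=
  ∀ ⦃N : C⦄ (i : N ⟶ M), Mono i →
    ∃ Q Z : C, Singular Q ∧ Projective Z ∧ Nonempty (N ≅ Q ⊞ Z)

/-- Every finitely generated subobject of `M` is the direct sum of a singular and a projective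
object. -/
def WeaklySemihereditary (M : C) : Prop :=
  ∀ ⦃N : C⦄ (i : N ⟶ M), Mono i → FinGen N →
    ∃ Q Z : C, Singular Q ∧ Projective Z ∧ Nonempty (N ≅ Q ⊞ Z)

/-- Every factor object of `M` is the direct sum of a small and an injective object. -/
def WeaklyCohereditary (M : C) : Prop :=
  ∀ ⦃N : C⦄ (p : M ⟶ N), Epi p →
    ∃ Q Z : C, SmallObj Q ∧ Injective Z ∧ Nonempty (N ≅ Q ⊞ Z)

/-- Every finitely cogenerated factor object of `M` is the direct sum of a small and an injective
object. -/
def WeaklySemicohereditary (M : C) : Prop :=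
  ∀ ⦃N : C⦄ (p : M ⟶ N), Epi p → FinCogen N →
    ∃ Q Z : C, SmallObj Q ∧ Injective Z ∧ Nonempty (N ≅ Q ⊞ Z)

end Defs

section Generators

variable (C : Type u) [Category.{v} C] [Abelian C]

/-- `C` has a (small) family of finitely generated projective generators. -/
def HasFinGenProjectiveGenerators : Prop :=
  ∃ (ι : Type w) (G : ι → C), (∀ i, FinGen (G i) ∧ Projective (G i)) ∧
    (ObjectProperty.ofObj G).IsSeparating

/-- `C` has a (small) family of finitely generated generators. -/
def LocallyFinGen : Prop :=
  ∃ (ι : Type w) (G : ι → C), (∀ i, FinGen (G i)) ∧ (ObjectProperty.ofObj G).IsSeparating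

end Generators

end CSRickart

/-!
Let `M` be projective and `f : M ⟶ N`. If `Ker f` is essential in a direct summand `L` of `M`, then
`Im f ≅ L / Ker f ⊞ M / L` is the sum of a singular and a projective object. Conversely, if
`Im f = Q ⊞ Z` with `Q` singular and `Z` projective, then the kernel `L` of `M ⟶ Z` is a direct
summand of `M` and `Ker f` is the kernel of `L ⟶ Q`, which is essential because `L` is projective.
So `M` is self-CS-Rickart if and only if the image of every endomorphism of `M` is such a sum.

A subobject `N` of `M` that is covered by a projective object `X` is the image of the endomorphism
`X ⊞ M ⟶ N ⟶ X ⊞ M`, which proves both equivalences of (1) once `X` can be chosen in the given class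
of objects. The equivalences of (2) are those of (1) in the opposite category. There `X` is an
injective hull, which is finitely cogenerated if `N` is. It is constructed as a maximal essential
extension of `N` inside an injective object.
-/

namespace CSRickart

open Opposite

variable {C : Type u} [Category.{v} C]

section Category

variable {M N : C}

theorem exists_map_eq_of_le_mk (i : N ⟶ M) [Mono i] {Y : Subobject M} (h : Y ≤ Subobject.mk i) :
    ∃ Y' : Subobject N, (Subobject.map i).obj Y' = Y :=
  ⟨Subobject.mk (Y.ofLEMk i h), by
    rw [Subobject.map_mk]
    exact Subobject.mk_eq_of_comm _ (Iso.refl _) (by simp)⟩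

theorem essentialMono_op_iff {f : M ⟶ N} : EssentialMono f.op ↔ SuperfluousEpi f :=
  ⟨fun h => ⟨(op_mono_iff f).1 h.1, fun _ g hg =>
      (op_mono_iff g).1 (h.2 g.op ((op_mono_iff (g ≫ f)).2 hg))⟩,
    fun h => ⟨(op_mono_iff f).2 h.1, fun _ g hg =>
      (unop_epi_iff g).1 (h.2 g.unop ((unop_epi_iff (f.op ≫ g)).2 hg))⟩⟩

theorem isSplitMono_op_iff {f : M ⟶ N} : IsSplitMono f.op ↔ IsSplitEpi f :=
  ⟨fun _ => ⟨⟨(retraction f.op).unop, Quiver.Hom.op_inj (IsSplitMono.id f.op)⟩⟩,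
    fun _ => inferInstance⟩

theorem projective_sigma {J : Type*} (F : J → C) [HasCoproduct F] (hF : ∀ j, Projective (F j)) :
    Projective (∐ F) :=
  ⟨fun f e _ => ⟨Sigma.desc fun j => Projective.factorThru (Sigma.ι F j ≫ f) e, by ext; simp⟩⟩

theorem enoughProjectives_of_isSeparating {P : ObjectProperty C} (hP : P.IsSeparating)
    (hproj : ∀ X, P X → Projective X) [ObjectProperty.Small.{w} P] [LocallySmall.{w} C]
    [HasCoproducts.{w} C] : EnoughProjectives C where
  presentation N := by
    have := hasCoproductsOfShape_of_small.{w} C (CostructuredArrow P.ι N)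
    have := projective_sigma (P.coproductFromFamily N) fun i => hproj _ i.left.2
    exact ⟨{ p := _, f := P.coproductFrom N, epi := hP.epi_coproductFrom N }⟩

end Category

variable [Abelian C]

section Subobject

variable {K L N : C}

theorem subobject_arrow_eq_zero_iff {X : Subobject L} : X.arrow = 0 ↔ X = ⊥ := by
  rw [← Subobject.mk_eq_bot_iff_zero, Subobject.mk_arrow]

theorem mk_le_kernelSubobject_iff {f : K ⟶ L} [Mono f] {g : L ⟶ N} :
    Subobject.mk f ≤ kernelSubobject g ↔ f ≫ g = 0 :=
  ⟨fun h => (kernelSubobject_factors_iff _ _).1 (Subobject.factors_of_le _ h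
      (Subobject.mk_factors_self f)),
    fun h => Subobject.mk_le_of_comm _ (factorThruKernelSubobject_comp_arrow g f h)⟩

theorem le_kernelSubobject_iff {X : Subobject L} {g : L ⟶ N} :
    X ≤ kernelSubobject g ↔ X.arrow ≫ g = 0 := by
  rw [← mk_le_kernelSubobject_iff, Subobject.mk_arrow]

theorem kernelSubobject_eq_bot_iff {g : L ⟶ N} : kernelSubobject g = ⊥ ↔ Mono g := by
  rw [Subobject.mk_eq_bot_iff_zero]
  exact ⟨fun h => Preadditive.mono_of_kernel_zero h, fun _ => kernel.ι_of_mono g⟩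

theorem kernelSubobject_eq_top_iff {g : L ⟶ N} : kernelSubobject g = ⊤ ↔ g = 0 := by
  rw [← top_le_iff, Subobject.top_eq_id, mk_le_kernelSubobject_iff, Category.id_comp]

theorem exact_kernelSubobject (g : L ⟶ N) :
    (ShortComplex.mk _ g (kernelSubobject_arrow_comp g)).Exact :=
  ShortComplex.exact_of_f_is_kernel _
    (IsLimit.ofIsoLimit (kernelIsKernel g) (Fork.ext (kernelSubobjectIso g).symm (by simp)))

theorem kernelSubobject_eq_mk {S : ShortComplex C} (hS : S.Exact) [Mono S.f] :
    kernelSubobject S.g = Subobject.mk S.f :=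
  le_antisymm (Subobject.le_mk_of_comm _ (hS.lift_f _ (kernelSubobject_arrow_comp _)))
    (mk_le_kernelSubobject_iff.2 S.zero)

theorem kernelSubobject_cokernel_π (f : K ⟶ L) [Mono f] :
    kernelSubobject (cokernel.π f) = Subobject.mk f :=
  kernelSubobject_eq_mk (ShortComplex.exact_cokernel f)

theorem exists_kernelSubobject_eq (X : Subobject L) :
    ∃ (N : C) (p : L ⟶ N), Epi p ∧ kernelSubobject p = X :=
  ⟨_, cokernel.π X.arrow, inferInstance, by rw [kernelSubobject_cokernel_π, Subobject.mk_arrow]⟩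

theorem mk_inf_kernelSubobject_eq_bot_iff {f : K ⟶ L} [Mono f] {g : L ⟶ N} :
    Subobject.mk f ⊓ kernelSubobject g = ⊥ ↔ Mono (f ≫ g) := by
  constructor
  · refine fun h => Preadditive.mono_of_cancel_zero _ fun x hx => zero_of_comp_mono f ?_
    rw [← Subobject.bot_factors_iff_zero, ← h, Subobject.inf_factors, Subobject.mk_factors_iff,
      kernelSubobject_factors_iff, Category.assoc]
    exact ⟨⟨x, rfl⟩, hx⟩
  · intro h
    obtain ⟨x, hx⟩ : ∃ x, x ≫ f = (Subobject.mk f ⊓ kernelSubobject g).arrow :=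
      (Subobject.mk_factors_iff _ _).1 (Subobject.factors_of_le _ inf_le_left
        (Subobject.factors_self _))
    have hx0 : x = 0 := by
      refine zero_of_comp_mono (f ≫ g) ?_
      rw [← Category.assoc, hx, ← le_kernelSubobject_iff]
      exact inf_le_right
    rw [← subobject_arrow_eq_zero_iff, ← hx, hx0, zero_comp]

theorem mk_sup_kernelSubobject_eq_top_iff {f : K ⟶ L} [Mono f] {g : L ⟶ N} [Epi g] :
    Subobject.mk f ⊔ kernelSubobject g = ⊤ ↔ Epi (f ≫ g) := by
  constructor
  · refine fun h => Preadditive.epi_of_cancel_zero _ fun y hy => zero_of_epi_comp g ?_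
    rw [← kernelSubobject_eq_top_iff, ← top_le_iff, ← h]
    exact sup_le (mk_le_kernelSubobject_iff.2 (by rwa [← Category.assoc]))
      (kernelSubobject_comp_le _ _)
  · intro h
    obtain ⟨T, c, _, hc⟩ := exists_kernelSubobject_eq (Subobject.mk f ⊔ kernelSubobject g)
    have hf : f ≫ c = 0 := mk_le_kernelSubobject_iff.1 (hc ▸ le_sup_left)
    obtain ⟨y, rfl⟩ := (exact_kernelSubobject g).desc' c
      (le_kernelSubobject_iff.1 (hc ▸ le_sup_right))
    have hy0 : y = 0 := zero_of_epi_comp (f ≫ g) (by rwa [Category.assoc])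
    rw [← hc, kernelSubobject_eq_top_iff, hy0, comp_zero]

theorem mono_of_kernelSubobject_comp_le {p : K ⟶ L} [Epi p] {g : L ⟶ N}
    (h : kernelSubobject (p ≫ g) ≤ kernelSubobject p) : Mono g := by
  refine Preadditive.mono_of_cancel_zero _ fun y hy => ?_
  obtain ⟨T, e, _, x, hx⟩ := surjective_up_to_refinements_of_epi p y
  have hxp : (kernelSubobject p).Factors x := Subobject.factors_of_le _ h
    ((kernelSubobject_factors_iff _ _).2 (by rw [← reassoc_of% hx, hy, comp_zero]))
  rw [kernelSubobject_factors_iff, ← hx] at hxp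
  exact zero_of_epi_comp e hxp

theorem essentialSubobject_mk_iff {f : K ⟶ L} [Mono f] :
    EssentialSubobject (Subobject.mk f) ↔ EssentialMono f := by
  constructor
  · intro h
    refine ⟨inferInstance, fun P g hg => ?_⟩
    rw [← mk_inf_kernelSubobject_eq_bot_iff] at hg
    exact kernelSubobject_eq_bot_iff.1 (h _ hg)
  · intro h X hX
    obtain ⟨N, p, _, rfl⟩ := exists_kernelSubobject_eq X
    rw [mk_inf_kernelSubobject_eq_bot_iff] at hX
    exact kernelSubobject_eq_bot_iff.2 (h.2 p hX)

end Subobject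

/-- The kernel of `g` is an essential subobject. The kernel itself is not mentioned, so that
`HasEssentialKernel f.op` says that the image of `f` is superfluous. -/
def HasEssentialKernel {L N : C} (g : L ⟶ N) : Prop :=
  ∀ ⦃T : C⦄ (k : T ⟶ L), Mono (k ≫ g) → k = 0

section EssentialKernel

variable {L M N : C}

theorem hasEssentialKernel_comp_mono_iff {g : L ⟶ M} {m : M ⟶ N} [Mono m] :
    HasEssentialKernel (g ≫ m) ↔ HasEssentialKernel g := by
  refine forall₂_congr fun T k => imp_congr_left ?_
  rw [← Category.assoc]
  exact ⟨fun _ => mono_of_mono _ m, fun _ => inferInstance⟩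

theorem essentialSubobject_kernelSubobject_iff {g : L ⟶ N} :
    EssentialSubobject (kernelSubobject g) ↔ HasEssentialKernel g := by
  constructor
  · intro h T k hk
    have : Mono k := mono_of_mono k g
    rw [← Subobject.mk_eq_bot_iff_zero]
    exact h _ (by rwa [inf_comm, mk_inf_kernelSubobject_eq_bot_iff])
  · intro h X hX
    rw [inf_comm, ← X.mk_arrow, mk_inf_kernelSubobject_eq_bot_iff] at hX
    exact subobject_arrow_eq_zero_iff.1 (h _ hX)

theorem superfluousSubobject_mk_iff {f : M ⟶ L} [Mono f] :
    SuperfluousSubobject (Subobject.mk f) ↔ HasEssentialKernel f.op := by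
  constructor
  · intro h T k hk
    have hepi : Epi (f ≫ k.unop) := inferInstanceAs (Epi (k ≫ f.op).unop)
    have : Epi k.unop := epi_of_epi f _
    exact Quiver.Hom.unop_inj
      (kernelSubobject_eq_top_iff.1 (h _ (mk_sup_kernelSubobject_eq_top_iff.2 hepi)))
  · intro h X hX
    obtain ⟨N, p, _, rfl⟩ := exists_kernelSubobject_eq X
    have := mk_sup_kernelSubobject_eq_top_iff.1 hX
    exact kernelSubobject_eq_top_iff.2 (Quiver.Hom.op_inj
      (h p.op (inferInstanceAs (Mono (f ≫ p).op))))

theorem singular_iff :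
    Singular M ↔ ∃ (L : C) (p : L ⟶ M), Epi p ∧ HasEssentialKernel p := by
  constructor
  · rintro ⟨L, K, hK, ⟨i⟩⟩
    refine ⟨L, cokernel.π K.arrow ≫ i.inv, inferInstance, ?_⟩
    rwa [hasEssentialKernel_comp_mono_iff, ← essentialSubobject_kernelSubobject_iff,
      kernelSubobject_cokernel_π, Subobject.mk_arrow]
  · rintro ⟨L, p, _, hp⟩
    exact ⟨L, kernelSubobject p, essentialSubobject_kernelSubobject_iff.2 hp,
      ⟨(ShortComplex.ShortExact.mk (exact_kernelSubobject p)).gIsCokernel.coconePointUniqueUpToIso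
        (colimit.isColimit _)⟩⟩

theorem smallObj_iff_singular_op : SmallObj M ↔ Singular (op M) := by
  rw [singular_iff]
  constructor
  · rintro ⟨L, K, hK, ⟨i⟩⟩
    refine ⟨op L, K.arrow.op ≫ i.hom.op, inferInstance, ?_⟩
    rwa [hasEssentialKernel_comp_mono_iff, ← superfluousSubobject_mk_iff, Subobject.mk_arrow]
  · rintro ⟨L, p, _, hp⟩
    exact ⟨L.unop, Subobject.mk p.unop, superfluousSubobject_mk_iff.2 hp,
      ⟨(Subobject.underlyingIso p.unop).symm⟩⟩

theorem Singular.hasEssentialKernel [Projective L] (hM : Singular M) (g : L ⟶ M) :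
    HasEssentialKernel g := by
  obtain ⟨P, p, _, hp⟩ := singular_iff.1 hM
  intro T k hk
  have hkg : (k ≫ Projective.factorThru g p) ≫ p = k ≫ g := by simp
  have hzero := hp (k ≫ Projective.factorThru g p) (by rwa [hkg])
  have hT : 𝟙 T = 0 := zero_of_comp_mono (k ≫ g) (by rw [← hkg, hzero, zero_comp, comp_zero])
  rw [← Category.id_comp k, hT, zero_comp]

end EssentialKernel

section Rickart

variable {L M N N' : C}

/-- `L` is a direct summand of `M`, embedded by `s`, in which the kernel of `f` is essential. -/
def KernelEssentialInSummand (f : M ⟶ N) : Prop :=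
  ∃ (L : C) (s : L ⟶ M) (_ : IsSplitMono s),
    kernelSubobject f ≤ Subobject.mk s ∧ HasEssentialKernel (s ≫ f)

theorem kernelEssentialInSummand_comp_mono_iff {f : M ⟶ N} {m : N ⟶ N'} [Mono m] :
    KernelEssentialInSummand (f ≫ m) ↔ KernelEssentialInSummand f := by
  simp only [KernelEssentialInSummand, kernelSubobject_comp_mono, ← Category.assoc,
    hasEssentialKernel_comp_mono_iff]

theorem mk_eq_kernelSubobject_comp {K L : C} {e : K ⟶ L} {s : L ⟶ M} [Mono e] [Mono s] {f : M ⟶ N}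
    (h : Subobject.mk (e ≫ s) = kernelSubobject f) : Subobject.mk e = kernelSubobject (s ≫ f) := by
  refine le_antisymm (mk_le_kernelSubobject_iff.2 ?_) ?_
  · rw [← Category.assoc, ← mk_le_kernelSubobject_iff, h]
  · obtain ⟨x, hx⟩ : ∃ x, x ≫ e ≫ s = (kernelSubobject (s ≫ f)).arrow ≫ s :=
      (Subobject.mk_factors_iff _ _).1 (h ▸ (kernelSubobject_factors_iff _ _).2 (by simp))
    exact Subobject.le_mk_of_comm x (by rwa [← cancel_mono s, Category.assoc])

theorem kernelEssentialInSummand_iff {K : C} {i : K ⟶ M} [Mono i] {f : M ⟶ N}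
    (hi : Subobject.mk i = kernelSubobject f) :
    KernelEssentialInSummand f ↔ ∃ (L : C) (e : K ⟶ L) (s : L ⟶ M),
      EssentialMono e ∧ IsSplitMono s ∧ e ≫ s = i := by
  have essentialMono_iff {L : C} {e : K ⟶ L} {s : L ⟶ M} [Mono s] [Mono e] (h : e ≫ s = i) :
      EssentialMono e ↔ HasEssentialKernel (s ≫ f) := by
    subst h
    rw [← essentialSubobject_mk_iff, mk_eq_kernelSubobject_comp hi,
      essentialSubobject_kernelSubobject_iff]
  rw [KernelEssentialInSummand, ← hi]
  constructor
  · rintro ⟨L, s, _, hle, hs⟩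
    have he := Subobject.ofMkLEMk_comp hle
    exact ⟨L, Subobject.ofMkLEMk _ _ hle, s, (essentialMono_iff he).2 hs, inferInstance, he⟩
  · rintro ⟨L, e, s, he, _, h⟩
    have := he.1
    exact ⟨L, s, inferInstance, Subobject.mk_le_mk_of_comm e h, (essentialMono_iff h).1 he⟩

/-- `N` is the direct sum of a singular and a projective object. -/
def IsSingularSumProjective (N : C) : Prop :=
  ∃ Q Z : C, Singular Q ∧ Projective Z ∧ Nonempty (N ≅ Q ⊞ Z)

theorem IsSingularSumProjective.kernelEssentialInSummand [Projective M]
    (hN : IsSingularSumProjective N) (p : M ⟶ N) [Epi p] : KernelEssentialInSummand p := by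
  obtain ⟨Q, Z, hQ, _, ⟨i⟩⟩ := hN
  let q : M ⟶ Z := p ≫ i.hom ≫ biprod.snd
  let σ := (ShortComplex.ShortExact.mk (ShortComplex.exact_kernel q)).splittingOfProjective
  have : Projective (kernel q) := (⟨kernel.ι q, σ.r, σ.f_r⟩ : Retract (kernel q) M).projective
  have hfst : kernel.ι q ≫ p ≫ i.hom = (kernel.ι q ≫ p ≫ i.hom ≫ biprod.fst) ≫ biprod.inl := by
    ext
    · simp
    · simp [q]
  refine ⟨kernel q, kernel.ι q, ⟨⟨σ.r, σ.f_r⟩⟩, kernelSubobject_comp_le p (i.hom ≫ biprod.snd), ?_⟩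
  rw [← hasEssentialKernel_comp_mono_iff (m := i.hom), Category.assoc, hfst,
    hasEssentialKernel_comp_mono_iff]
  exact hQ.hasEssentialKernel _

theorem epi_kernelLift_of_comp_eq_cokernel_π {s : L ⟶ M} [Mono s] {p : M ⟶ N} [Epi p]
    {b : N ⟶ cokernel s} (hb : p ≫ b = cokernel.π s) :
    Epi (kernel.lift b (s ≫ p) (by rw [Category.assoc, hb, cokernel.condition])) := by
  rw [epi_iff_surjective_up_to_refinements]
  intro T y
  obtain ⟨T', π, hπ, x, hx⟩ := surjective_up_to_refinements_of_epi p (y ≫ kernel.ι b)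
  obtain ⟨z, hz⟩ := (ShortComplex.exact_cokernel s).lift' x (by
    simp [← hb, ← reassoc_of% hx])
  refine ⟨T', π, hπ, z, ?_⟩
  dsimp only at z hz
  rw [← cancel_mono (kernel.ι b), Category.assoc, hx, Category.assoc, kernel.lift_ι,
    reassoc_of% hz]

theorem KernelEssentialInSummand.isSingularSumProjective [Projective M] {p : M ⟶ N} [Epi p]
    (h : KernelEssentialInSummand p) : IsSingularSumProjective N := by
  obtain ⟨L, s, _, hle, hs⟩ := h
  rw [← kernelSubobject_cokernel_π s, le_kernelSubobject_iff] at hle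
  obtain ⟨b, hb⟩ : ∃ b, p ≫ b = cokernel.π s := (exact_kernelSubobject p).desc' _ hle
  have : Epi b := epi_of_epi_fac hb
  let σ := ShortComplex.Splitting.ofExactOfRetraction _ (ShortComplex.exact_cokernel s)
    (retraction s) (by simp) inferInstance
  have hZ : Projective (cokernel s) := (⟨σ.s, cokernel.π s, σ.s_g⟩ : Retract _ M).projective
  refine ⟨kernel b, cokernel s, singular_iff.2 ⟨L, _, epi_kernelLift_of_comp_eq_cokernel_π hb, ?_⟩,
    hZ, ⟨(ShortComplex.ShortExact.mk
      (ShortComplex.exact_kernel b)).splittingOfProjective.isoBinaryBiproduct⟩⟩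
  rwa [← hasEssentialKernel_comp_mono_iff (m := kernel.ι b), kernel.lift_ι]

theorem kernelEssentialInSummand_iff_of_epi [Projective M] (p : M ⟶ N) [Epi p] :
    KernelEssentialInSummand p ↔ IsSingularSumProjective N :=
  ⟨fun h => h.isSingularSumProjective, fun h => h.kernelEssentialInSummand p⟩

theorem relCSRickart_iff : RelCSRickart M N ↔ ∀ f : M ⟶ N, KernelEssentialInSummand f :=
  forall_congr' fun _ => (kernelEssentialInSummand_iff rfl).symm

theorem relCSRickart_iff_image [Projective M] :
    RelCSRickart M N ↔ ∀ f : M ⟶ N, IsSingularSumProjective (image f) := by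
  refine relCSRickart_iff.trans (forall_congr' fun f => ?_)
  rw [← kernelEssentialInSummand_iff_of_epi (factorThruImage f),
    ← kernelEssentialInSummand_comp_mono_iff (m := image.ι f), image.fac]

end Rickart

section Duality

variable {M N : C}

theorem mk_cokernel_π_op (f : M ⟶ N) :
    Subobject.mk (cokernel.π f).op = kernelSubobject f.op := by
  refine le_antisymm (mk_le_kernelSubobject_iff.2 ?_) (Subobject.le_mk_of_comm
    (cokernel.desc f (kernelSubobject f.op).arrow.unop ?_).op ?_)
  · rw [← op_comp, cokernel.condition, op_zero]
  · exact Quiver.Hom.op_inj (kernelSubobject_arrow_comp f.op)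
  · exact Quiver.Hom.unop_inj (cokernel.π_desc _ _ _)

theorem dualRelCSRickart_iff_relCSRickart_op :
    DualRelCSRickart M N ↔ RelCSRickart (op N) (op M) := by
  have factorization_iff (f : M ⟶ N) : (∃ (P : C) (r : N ⟶ P) (t : P ⟶ cokernel f),
      IsSplitEpi r ∧ SuperfluousEpi t ∧ r ≫ t = cokernel.π f) ↔ KernelEssentialInSummand f.op := by
    rw [kernelEssentialInSummand_iff (mk_cokernel_π_op f)]
    constructor
    · rintro ⟨P, r, t, hr, ht, h⟩
      exact ⟨op P, t.op, r.op, essentialMono_op_iff.2 ht, isSplitMono_op_iff.2 hr, congrArg _ h⟩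
    · rintro ⟨L, e, s, he, hs, h⟩
      exact ⟨L.unop, s.unop, e.unop, isSplitMono_op_iff.1 hs, essentialMono_op_iff.1 he,
        congrArg Quiver.Hom.unop h⟩
  constructor
  · exact fun h f => (kernelEssentialInSummand_iff rfl).1 ((factorization_iff f.unop).1 (h f.unop))
  · exact fun h f => (factorization_iff f).2 ((kernelEssentialInSummand_iff rfl).2 (h f.op))

/-- `N` is the direct sum of a small and an injective object. -/
def IsSmallSumInjective (N : C) : Prop :=
  ∃ Q Z : C, SmallObj Q ∧ Injective Z ∧ Nonempty (N ≅ Q ⊞ Z)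

theorem isSmallSumInjective_iff_isSingularSumProjective_op :
    IsSmallSumInjective N ↔ IsSingularSumProjective (op N) := by
  constructor
  · rintro ⟨Q, Z, hQ, _, ⟨i⟩⟩
    exact ⟨op Q, op Z, smallObj_iff_singular_op.1 hQ, inferInstance,
      ⟨i.symm.op ≪≫ biprod.opIso Q Z⟩⟩
  · rintro ⟨Q, Z, hQ, _, ⟨i⟩⟩
    exact ⟨Q.unop, Z.unop, smallObj_iff_singular_op.2 hQ, inferInstance,
      ⟨(biprod.opIso Q.unop Z.unop ≪≫ i.symm).unop⟩⟩

end Duality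

section Classes

variable (P : ObjectProperty C)

instance [P.IsClosedUnderSubobjects] : P.op.IsClosedUnderQuotients where
  prop_of_epi f _ hX := P.prop_of_mono f.unop hX

instance [P.IsClosedUnderExtensions] : P.op.IsClosedUnderExtensions where
  prop_X₂_of_shortExact hS h₁ h₃ := P.prop_X₂_of_shortExact hS.unop h₃ h₁

theorem forall_isSingularSumProjective_iff_forall_selfCSRickart
    [P.IsClosedUnderQuotients] [P.IsClosedUnderExtensions]
    (hP : ∀ ⦃N : C⦄, P N → ∃ (X : C) (p : X ⟶ N), P X ∧ Projective X ∧ Epi p) :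
    (∀ M : C, P M → Projective M →
      ∀ ⦃N : C⦄ (i : N ⟶ M), Mono i → P N → IsSingularSumProjective N) ↔
    ∀ M : C, P M → Projective M → SelfCSRickart M := by
  constructor
  · intro h M hM _
    exact relCSRickart_iff_image.2 fun f =>
      h M hM inferInstance (image.ι f) inferInstance (P.prop_of_epi (factorThruImage f) hM)
  · intro h M hM _ N i _ hN
    obtain ⟨X, p, hX, _, _⟩ := hP hN
    have hf := relCSRickart_iff.1 (h (X ⊞ M) (P.prop_biprod hX hM) inferInstance)
      ((biprod.fst ≫ p) ≫ i ≫ biprod.inr)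
    rwa [kernelEssentialInSummand_comp_mono_iff, kernelEssentialInSummand_iff_of_epi] at hf

theorem forall_isSmallSumInjective_iff_forall_dualSelfCSRickart
    [P.IsClosedUnderSubobjects] [P.IsClosedUnderExtensions]
    (hP : ∀ ⦃N : C⦄, P N → ∃ (X : C) (i : N ⟶ X), P X ∧ Injective X ∧ Mono i) :
    (∀ M : C, P M → Injective M →
      ∀ ⦃N : C⦄ (p : M ⟶ N), Epi p → P N → IsSmallSumInjective N) ↔
    ∀ M : C, P M → Injective M → DualSelfCSRickart M := by
  have iff_op := forall_isSingularSumProjective_iff_forall_selfCSRickart P.op fun N hN =>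
    have ⟨X, i, hX, _, _⟩ := hP hN
    ⟨op X, i.op, hX, inferInstance, inferInstance⟩
  constructor
  · intro h M hM _
    exact dualRelCSRickart_iff_relCSRickart_op.2 (iff_op.1 (fun M' hM' _ N i _ hN =>
      isSmallSumInjective_iff_isSingularSumProjective_op.1
        (h M'.unop hM' inferInstance i.unop inferInstance hN)) (op M) hM inferInstance)
  · intro h M hM _ N p _ hN
    exact isSmallSumInjective_iff_isSingularSumProjective_op.2 (iff_op.2 (fun M' hM' _ =>
      dualRelCSRickart_iff_relCSRickart_op.1 (h M'.unop hM' inferInstance))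
        (op M) hM inferInstance p.op inferInstance hN)

variable (C) in
theorem forall_weaklyHereditary_iff [EnoughProjectives C] :
    (∀ M : C, Projective M → WeaklyHereditary M) ↔ ∀ M : C, Projective M → SelfCSRickart M := by
  simpa [WeaklyHereditary, IsSingularSumProjective] using
    forall_isSingularSumProjective_iff_forall_selfCSRickart (⊤ : ObjectProperty C) fun N _ =>
      ⟨Projective.over N, Projective.π N, trivial, inferInstance, inferInstance⟩

variable (C) in
theorem forall_weaklyCohereditary_iff [EnoughInjectives C] :
    (∀ M : C, Injective M → WeaklyCohereditary M) ↔
      ∀ M : C, Injective M → DualSelfCSRickart M := by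
  simpa [WeaklyCohereditary, IsSmallSumInjective] using
    forall_isSmallSumInjective_iff_forall_dualSelfCSRickart (⊤ : ObjectProperty C) fun N _ =>
      ⟨Injective.under N, Injective.ι N, trivial, inferInstance, inferInstance⟩

end Classes

section Finiteness

theorem exists_finset_isLUB_top_iff_of_orderIso {α β : Type*} [PartialOrder α] [OrderTop α]
    [PartialOrder β] [OrderBot β] (e : α ≃o βᵒᵈ) :
    (∀ S : Set α, IsLUB S ⊤ → ∃ t : Finset α, (t : Set α) ⊆ S ∧ IsLUB (t : Set α) ⊤) ↔
      ∀ S : Set β, IsGLB S ⊥ → ∃ t : Finset β, (t : Set β) ⊆ S ∧ IsGLB (t : Set β) ⊥ := by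
  classical
  let f : α → β := fun a => OrderDual.ofDual (e a)
  have hf : Function.Surjective f := e.surjective
  have isLUB_top_iff (S : Set α) : IsLUB S ⊤ ↔ IsGLB (f '' S) ⊥ := by
    rw [← e.isLUB_image', map_top]
    exact Iff.rfl
  constructor
  · intro h S hS
    obtain ⟨t, ht, hlub⟩ := h (f ⁻¹' S) ((isLUB_top_iff _).2 (by rwa [Set.image_preimage_eq _ hf]))
    refine ⟨t.image f, by simpa using ht, ?_⟩
    rw [Finset.coe_image]
    exact (isLUB_top_iff _).1 hlub
  · intro h S hS
    obtain ⟨t, ht, hglb⟩ := h (f '' S) ((isLUB_top_iff _).1 hS)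
    obtain ⟨t, htS, rfl⟩ := Finset.subset_set_image_iff.1 ht
    rw [Finset.coe_image] at hglb
    exact ⟨t, htS, (isLUB_top_iff _).2 hglb⟩

variable {M N : C}

theorem finGen_iff : FinGen M ↔ ∀ S : Set (Subobject M), IsLUB S ⊤ →
    ∃ t : Finset (Subobject M), (t : Set (Subobject M)) ⊆ S ∧
      IsLUB (t : Set (Subobject M)) ⊤ := by
  refine forall₂_congr fun S _ => exists_congr fun t => and_congr_right fun _ => ?_
  have h : IsLUB (t : Set (Subobject M)) (t.sup id) := Finset.isLUB_sup_id
  exact ⟨fun h' => h' ▸ h, fun h' => h.unique h'⟩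

theorem finCogen_iff : FinCogen M ↔ ∀ S : Set (Subobject M), IsGLB S ⊥ →
    ∃ t : Finset (Subobject M), (t : Set (Subobject M)) ⊆ S ∧
      IsGLB (t : Set (Subobject M)) ⊥ := by
  refine forall₂_congr fun S _ => exists_congr fun t => and_congr_right fun _ => ?_
  have h : IsGLB (t : Set (Subobject M)) (t.inf id) := Finset.isGLB_inf_id
  exact ⟨fun h' => h' ▸ h, fun h' => h.unique h'⟩

theorem finGen_iff_finCogen_op : FinGen M ↔ FinCogen (op M) := by
  rw [finGen_iff, finCogen_iff]
  exact exists_finset_isLUB_top_iff_of_orderIso (Abelian.subobjectIsoSubobjectOp M)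

theorem isGLB_bot_iff {α : Type*} [PartialOrder α] [OrderBot α] {S : Set α} :
    IsGLB S ⊥ ↔ ∀ Y, (∀ X ∈ S, Y ≤ X) → Y = ⊥ :=
  ⟨fun h _ hY => le_bot_iff.1 (h.2 hY), fun h => ⟨fun _ _ => bot_le, fun _ hY => (h _ hY).le⟩⟩

theorem map_le_iff (i : N ⟶ M) [Mono i] {Y : Subobject N} {X : Subobject M} :
    (Subobject.map i).obj Y ≤ X ↔ Y ≤ (Subobject.pullback i).obj X :=
  (Subobject.mapPullbackAdj i).gc Y X

theorem map_eq_bot_iff (i : N ⟶ M) [Mono i] {Y : Subobject N} :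
    (Subobject.map i).obj Y = ⊥ ↔ Y = ⊥ := by
  rw [← (Subobject.map_obj_injective i).eq_iff (b := ⊥), Subobject.map_bot]

theorem finCogen_iff_of_mono (i : N ⟶ M) [Mono i] :
    FinCogen N ↔ ∀ S : Set (Subobject M), (∀ Y ≤ Subobject.mk i, (∀ X ∈ S, Y ≤ X) → Y = ⊥) →
      ∃ t : Finset (Subobject M), (t : Set (Subobject M)) ⊆ S ∧
        ∀ Y ≤ Subobject.mk i, (∀ X ∈ t, Y ≤ X) → Y = ⊥ := by
  classical
  have hle (Y : Subobject N) : (Subobject.map i).obj Y ≤ Subobject.mk i :=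
    Subobject.map_top i ▸ (Subobject.map i).monotone le_top
  simp only [finCogen_iff, isGLB_bot_iff]
  constructor
  · intro h S hS
    obtain ⟨t, ht, ht'⟩ := h ((Subobject.pullback i).obj '' S) fun Y hY =>
      (map_eq_bot_iff i).1 (hS _ (hle Y) fun X hX =>
        (map_le_iff i).2 (hY _ (Set.mem_image_of_mem _ hX)))
    obtain ⟨t, htS, rfl⟩ := Finset.subset_set_image_iff.1 ht
    refine ⟨t, htS, fun Y hY hYt => ?_⟩
    obtain ⟨Y, rfl⟩ := exists_map_eq_of_le_mk i hY
    rw [map_eq_bot_iff]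
    exact ht' Y (Finset.forall_mem_image.2 fun X hX => (map_le_iff i).1 (hYt X hX))
  · intro h S hS
    obtain ⟨t, ht, ht'⟩ := h ((Subobject.map i).obj '' S) fun Y hY hYS => by
      obtain ⟨Y, rfl⟩ := exists_map_eq_of_le_mk i hY
      rw [map_eq_bot_iff]
      exact hS Y fun X hX => by
        simpa only [map_le_iff, Subobject.pullback_map_self] using
          hYS _ (Set.mem_image_of_mem _ hX)
    obtain ⟨t, htS, rfl⟩ := Finset.subset_set_image_iff.1 ht
    exact ⟨t, htS, fun Y hY => (map_eq_bot_iff i).1 (ht' _ (hle Y)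
      (Finset.forall_mem_image.2 fun X hX => (Subobject.map i).monotone (hY X hX)))⟩

theorem FinCogen.of_mono (hM : FinCogen M) (i : N ⟶ M) [Mono i] : FinCogen N := by
  classical
  refine (finCogen_iff_of_mono i).2 fun S hS => ?_
  obtain ⟨t, ht, ht'⟩ := finCogen_iff.1 hM (insert (Subobject.mk i) S) (isGLB_bot_iff.2
    fun Y hY => hS Y (hY _ (Set.mem_insert _ _)) fun X hX => hY X (Set.mem_insert_of_mem _ hX))
  refine ⟨t.erase (Subobject.mk i), by simpa [Set.sdiff_subset_iff] using ht,
    fun Y hY hYt => isGLB_bot_iff.1 ht' Y fun X hX => ?_⟩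
  by_cases hXi : X = Subobject.mk i
  · exact hXi ▸ hY
  · exact hYt X (Finset.mem_erase.2 ⟨hXi, hX⟩)

theorem FinCogen.of_essentialMono (hN : FinCogen N) {i : N ⟶ M} (hi : EssentialMono i) :
    FinCogen M := by
  have := hi.1
  refine finCogen_iff.2 fun S hS => ?_
  obtain ⟨t, ht, ht'⟩ := (finCogen_iff_of_mono i).1 hN S fun Y _ => isGLB_bot_iff.1 hS Y
  exact ⟨t, ht, isGLB_bot_iff.2 fun Y hY => essentialSubobject_mk_iff.2 hi Y
    (ht' _ inf_le_left fun X hX => inf_le_right.trans (hY X hX))⟩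

instance : ObjectProperty.IsClosedUnderSubobjects (FinCogen (C := C)) where
  prop_of_mono i _ hM := hM.of_mono i

-- If finitely many members of `S` have intersection `A` with `A ⊓ X₁ = ⊥`, then `A` embeds in `X₃`,
-- and finitely many further members of `S` suffice to cut `A` down to `⊥`.
instance : ObjectProperty.IsClosedUnderExtensions (FinCogen (C := C)) where
  prop_X₂_of_shortExact {S} hS h₁ h₃ := by
    classical
    have := hS.mono_f
    refine finCogen_iff.2 fun s hs => ?_
    rw [isGLB_bot_iff] at hs
    obtain ⟨t₁, ht₁, h₁⟩ := (finCogen_iff_of_mono S.f).1 h₁ s fun Y _ => hs Y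
    let A := t₁.inf id
    have hA : Mono (A.arrow ≫ S.g) := by
      rw [← mk_inf_kernelSubobject_eq_bot_iff, kernelSubobject_eq_mk hS.exact, Subobject.mk_arrow]
      exact h₁ _ inf_le_right fun X hX => inf_le_left.trans (Finset.inf_le hX)
    obtain ⟨t₃, ht₃, h₃⟩ := (finCogen_iff_of_mono A.arrow).1 (h₃.of_mono (A.arrow ≫ S.g)) s
      fun Y _ => hs Y
    refine ⟨t₁ ∪ t₃, by simp [ht₁, ht₃], isGLB_bot_iff.2 fun Y hY => h₃ Y ?_ fun X hX =>
      hY X (Finset.mem_union_right _ hX)⟩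
    rw [Subobject.mk_arrow]
    exact Finset.le_inf fun X hX => hY X (Finset.mem_union_left _ hX)

instance : ObjectProperty.IsClosedUnderQuotients (FinGen (C := C)) where
  prop_of_epi p _ hM :=
    finGen_iff_finCogen_op.2 ((finGen_iff_finCogen_op.1 hM).of_mono p.op)

instance : ObjectProperty.IsClosedUnderExtensions (FinGen (C := C)) where
  prop_X₂_of_shortExact hS h₁ h₃ :=
    finGen_iff_finCogen_op.2 (ObjectProperty.prop_X₂_of_shortExact FinCogen hS.op
      (finGen_iff_finCogen_op.1 h₃) (finGen_iff_finCogen_op.1 h₁))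

end Finiteness

section Generators

open ZeroObject

variable {ι : Type*} {G : ι → C}

theorem isLUB_imageSubobject_of_isSeparating (hG : (ObjectProperty.ofObj G).IsSeparating) (N : C) :
    IsLUB {X | ∃ (i : ι) (f : G i ⟶ N), imageSubobject f = X} ⊤ := by
  refine ⟨fun _ _ => le_top, fun Y hY => ?_⟩
  obtain ⟨T, p, _, rfl⟩ := exists_kernelSubobject_eq Y
  rw [top_le_iff, kernelSubobject_eq_top_iff]
  refine hG _ _ ?_
  rintro _ ⟨i⟩ f
  rw [comp_zero, ← imageSubobject_arrow_comp f, Category.assoc,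
    le_kernelSubobject_iff.1 (hY ⟨i, f, rfl⟩), comp_zero]

theorem finGen_zero : FinGen (0 : C) := by
  have := Subobject.subsingleton_of_isZero (isZero_zero C)
  exact fun S _ => ⟨∅, by simp, Subsingleton.elim _ _⟩

theorem FinGen.exists_epi_of_isSeparating (hG : ∀ i, FinGen (G i) ∧ Projective (G i))
    (hsep : (ObjectProperty.ofObj G).IsSeparating) {N : C} (hN : FinGen N) :
    ∃ (X : C) (p : X ⟶ N), FinGen X ∧ Projective X ∧ Epi p := by
  obtain ⟨t, ht, htop⟩ := hN _ (isLUB_imageSubobject_of_isSeparating hsep N)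
  obtain ⟨X, p, hX, hX', hp⟩ : ∃ (X : C) (p : X ⟶ N), FinGen X ∧ Projective X ∧
      t.sup id ≤ imageSubobject p := by
    refine Finset.sup_induction (p := fun Y => ∃ (X : C) (p : X ⟶ N), FinGen X ∧ Projective X ∧
      Y ≤ imageSubobject p) ⟨0, 0, finGen_zero, inferInstance, bot_le⟩ ?_ fun Y hY => ?_
    · rintro Y₁ ⟨X₁, p₁, h₁, _, hY₁⟩ Y₂ ⟨X₂, p₂, h₂, _, hY₂⟩
      refine ⟨X₁ ⊞ X₂, biprod.desc p₁ p₂, ObjectProperty.prop_biprod FinGen h₁ h₂, inferInstance,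
        sup_le (hY₁.trans ?_) (hY₂.trans ?_)⟩
      · simpa using imageSubobject_comp_le biprod.inl (biprod.desc p₁ p₂)
      · simpa using imageSubobject_comp_le biprod.inr (biprod.desc p₁ p₂)
    · obtain ⟨i, f, rfl⟩ := ht hY
      exact ⟨G i, f, (hG i).1, (hG i).2, le_rfl⟩
  refine ⟨X, p, hX, hX', ?_⟩
  rw [htop, top_le_iff, ← Subobject.isIso_arrow_iff_eq_top] at hp
  rw [← imageSubobject_arrow_comp p]
  infer_instance

theorem HasFinGenProjectiveGenerators.enoughProjectives [LocallySmall.{w} C] [HasCoproducts.{w} C]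
    (hC : HasFinGenProjectiveGenerators.{w} C) : EnoughProjectives C := by
  obtain ⟨ι, G, hG, hsep⟩ := hC
  exact enoughProjectives_of_isSeparating hsep fun _ ⟨i⟩ => (hG i).2

theorem HasFinGenProjectiveGenerators.forall_weaklySemihereditary_iff
    (hC : HasFinGenProjectiveGenerators.{w} C) :
    (∀ M : C, FinGen M → Projective M → WeaklySemihereditary M) ↔
      ∀ M : C, FinGen M → Projective M → SelfCSRickart M := by
  obtain ⟨ι, G, hG, hsep⟩ := hC
  exact forall_isSingularSumProjective_iff_forall_selfCSRickart FinGen fun N hN =>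
    hN.exists_epi_of_isSeparating hG hsep

end Generators

section InjectiveHulls

variable {E : C}

/-- `N` is an essential subobject of `K`, where both are regarded as subobjects of `E` so that
essential extensions inside `E` can be compared. -/
def IsEssentialIn (N K : Subobject E) : Prop :=
  N ≤ K ∧ ∀ X ≤ K, X ⊓ N = ⊥ → X = ⊥

theorem IsEssentialIn.trans {N K L : Subobject E} (hNK : IsEssentialIn N K)
    (hKL : IsEssentialIn K L) : IsEssentialIn N L := by
  refine ⟨hNK.1.trans hKL.1, fun X hX hXN => hKL.2 X hX (hNK.2 _ inf_le_right ?_)⟩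
  rw [inf_assoc, inf_eq_right.2 hNK.1, hXN]

theorem essentialMono_iff_isEssentialIn {N K : C} (i : N ⟶ K) (k : K ⟶ E) [Mono i] [Mono k] :
    EssentialMono i ↔ IsEssentialIn (Subobject.mk (i ≫ k)) (Subobject.mk k) := by
  have hi (X : Subobject K) :
      (Subobject.map k).obj X ⊓ Subobject.mk (i ≫ k) = ⊥ ↔ Subobject.mk i ⊓ X = ⊥ := by
    rw [← Subobject.map_mk, ← Subobject.inf_map, map_eq_bot_iff, inf_comm]
  rw [← essentialSubobject_mk_iff]
  constructor
  · refine fun h => ⟨Subobject.mk_le_mk_of_comm i rfl, fun X hX hXi => ?_⟩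
    obtain ⟨X, rfl⟩ := exists_map_eq_of_le_mk k hX
    exact (map_eq_bot_iff k).2 (h X ((hi X).1 hXi))
  · refine fun h X hX => (map_eq_bot_iff k).1 (h.2 _ ?_ ((hi X).2 hX))
    exact ((Subobject.map k).monotone le_top).trans_eq (Subobject.map_top k)

/-- Every object has an injective hull: an essential monomorphism to an injective object. -/
def HasInjectiveHulls (C : Type u) [Category.{v} C] : Prop :=
  ∀ N : C, ∃ (E : C) (i : N ⟶ E), Injective E ∧ EssentialMono i

theorem HasInjectiveHulls.forall_weaklySemicohereditary_iff (hC : HasInjectiveHulls C) :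
    (∀ M : C, FinCogen M → Injective M → WeaklySemicohereditary M) ↔
      ∀ M : C, FinCogen M → Injective M → DualSelfCSRickart M :=
  forall_isSmallSumInjective_iff_forall_dualSelfCSRickart FinCogen fun N hN =>
    have ⟨E, i, hE, hi⟩ := hC N
    ⟨E, i, hN.of_essentialMono hi, hE, hi.1⟩

variable [IsGrothendieckAbelian.{w} C]

theorem iSup_inf_eq_bot_of_monotone {J : Type w} [Preorder J] [IsDirectedOrder J] [Nonempty J]
    {K : J → Subobject E} (hK : Monotone K) {Y : Subobject E} (hY : ∀ j, K j ⊓ Y = ⊥) :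
    (⨆ j, K j) ⊓ Y = ⊥ := by
  obtain ⟨T, p, _, rfl⟩ := exists_kernelSubobject_eq Y
  have hp (j : J) : Mono ((K j).arrow ≫ p) := by
    rw [← mk_inf_kernelSubobject_eq_bot_iff, Subobject.mk_arrow]
    exact hY j
  let F : J ⥤ MonoOver E :=
    { obj j := MonoOver.mk (K j).arrow
      map f := MonoOver.homMk (Subobject.ofLE _ _ (hK (leOfHom f))) }
  let G : J ⥤ C := F ⋙ MonoOver.forget _ ⋙ Over.forget _
  let α : G ⟶ (Functor.const J).obj E :=
    { app j := (K j).arrow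
      naturality _ _ g :=
        (Subobject.ofLE_arrow (hK (leOfHom g))).trans (Category.comp_id _).symm }
  let f : colimit G ⟶ E := colimit.desc G ⟨E, α⟩
  have hf (j : J) : colimit.ι G j ≫ f = (K j).arrow := colimit.ι_desc _ _
  have : Mono f := IsGrothendieckAbelian.mono_of_isColimit_monoOver F (colimit.isColimit _) f hf
  have hsup : Subobject.mk f = ⨆ j, K j :=
    (IsGrothendieckAbelian.subobjectMk_of_isColimit_eq_iSup F (colimit.isColimit _) f hf).trans
      (iSup_congr fun j => Subobject.mk_arrow (K j))
  rw [← hsup, mk_inf_kernelSubobject_eq_bot_iff]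
  let β : G ⟶ (Functor.const J).obj T := α ≫ (Functor.const J).map p
  have (j : J) : Mono (β.app j) := hp j
  have := NatTrans.mono_of_mono_app β
  have := IsFiltered.isConnected J
  refine colim.map_mono' β (colimit.isColimit _) (isColimitConstCocone J T) _ fun j => ?_
  exact (Category.assoc _ _ _).symm.trans ((hf j =≫ p).trans (Category.comp_id _).symm)

theorem sSup_inf_eq_bot_of_directedOn {c : Set (Subobject E)} (hc : DirectedOn (· ≤ ·) c)
    (hne : c.Nonempty) {Y : Subobject E} (hY : ∀ K ∈ c, K ⊓ Y = ⊥) : sSup c ⊓ Y = ⊥ := by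
  let e : Shrink.{w} c ≃o c := (orderIsoShrink c).symm
  have : Nonempty (Shrink.{w} c) := hne.to_subtype.map e.symm
  have : IsDirectedOrder c := hc.isDirectedOrder
  have : IsDirectedOrder (Shrink.{w} c) := ⟨fun i j =>
    have ⟨k, hi, hj⟩ := exists_ge_ge (e i) (e j)
    ⟨e.symm k, e.le_symm_apply.2 hi, e.le_symm_apply.2 hj⟩⟩
  rw [sSup_eq_iSup', ← e.surjective.iSup_comp]
  exact iSup_inf_eq_bot_of_monotone (fun _ _ h => e.monotone h) fun j => hY _ (e j).2

theorem exists_essentialMono_arrow_comp_cokernel_π (K : Subobject E) :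
    ∃ X : Subobject E, EssentialMono (K.arrow ≫ cokernel.π X.arrow) := by
  obtain ⟨X, -, hX⟩ := zorn_le_nonempty₀ {X : Subobject E | X ⊓ K = ⊥} (fun c hcs hc y hy =>
    ⟨sSup c, sSup_inf_eq_bot_of_directedOn hc.directedOn ⟨y, hy⟩ hcs, fun _ => le_sSup⟩) ⊥
      (bot_inf_eq K)
  have hker : kernelSubobject (cokernel.π X.arrow) = X := by
    rw [kernelSubobject_cokernel_π, Subobject.mk_arrow]
  have hmono {T : C} (g : E ⟶ T) : Mono (K.arrow ≫ g) ↔ kernelSubobject g ⊓ K = ⊥ := by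
    rw [← mk_inf_kernelSubobject_eq_bot_iff, Subobject.mk_arrow, inf_comm]
  refine ⟨X, (hmono _).2 (hker.symm ▸ hX.prop), fun T g hg => ?_⟩
  rw [Category.assoc, hmono] at hg
  refine mono_of_kernelSubobject_comp_le (p := cokernel.π X.arrow) ?_
  rw [hker]
  exact hX.le_of_ge hg (hker.symm.le.trans (kernelSubobject_comp_le _ _))

theorem exists_maximal_isEssentialIn (N : Subobject E) : ∃ K, Maximal (IsEssentialIn N) K := by
  obtain ⟨K, -, hK⟩ := zorn_le_nonempty₀ {K | IsEssentialIn N K} (fun c hcs hc y hy => by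
    refine ⟨sSup c, ⟨(hcs hy).1.trans (le_sSup hy), fun X hX hXN => ?_⟩, fun _ => le_sSup⟩
    rw [← inf_eq_right.2 hX]
    refine sSup_inf_eq_bot_of_directedOn hc.directedOn ⟨y, hy⟩ fun K hK =>
      (hcs hK).2 _ inf_le_left ?_
    rw [inf_assoc, hXN, inf_bot_eq]) N ⟨le_rfl, fun X hX h => by rwa [inf_eq_left.2 hX] at h⟩
  exact ⟨K, hK⟩

-- The embedding of `K` in `E` extends to its essential extension `E / X`, and the image of the
-- extended map is essential over `N`, hence no larger than `K`.
theorem injective_of_maximal_isEssentialIn [Injective E] {N K : Subobject E}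
    (hK : Maximal (IsEssentialIn N) K) : Injective (K : C) := by
  obtain ⟨X, hj⟩ := exists_essentialMono_arrow_comp_cokernel_π K
  have := hj.1
  let φ : cokernel X.arrow ⟶ E := Injective.factorThru K.arrow (K.arrow ≫ cokernel.π X.arrow)
  have hφ : (K.arrow ≫ cokernel.π X.arrow) ≫ φ = K.arrow := Injective.comp_factorThru _ _
  have : Mono φ := hj.2 φ (by rw [hφ]; infer_instance)
  have hKφ : IsEssentialIn K (Subobject.mk φ) := by
    simpa only [hφ, Subobject.mk_arrow] using (essentialMono_iff_isEssentialIn _ φ).1 hj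
  have hφK : Subobject.mk φ ≤ K := hK.le_of_ge (hK.prop.trans hKφ) hKφ.1
  refine Retract.injective (Y := E) ⟨K.arrow, cokernel.π X.arrow ≫ Subobject.ofMkLE φ K hφK, ?_⟩
  rw [← cancel_mono K.arrow]
  simpa using hφ

variable (C) in
theorem hasInjectiveHulls : HasInjectiveHulls C := by
  intro N
  obtain ⟨K, hK⟩ := exists_maximal_isEssentialIn (Subobject.mk (Injective.ι N))
  refine ⟨K, Subobject.ofMkLE _ K hK.prop.1, injective_of_maximal_isEssentialIn hK, ?_⟩
  rw [essentialMono_iff_isEssentialIn _ K.arrow]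
  simpa using hK.prop

end InjectiveHulls

end CSRickart

theorem theoremt_general {C : Type u} [Category.{v} C] [Abelian C] :
    (EnoughProjectives C →
      ((∀ M : C, Projective M → CSRickart.WeaklyHereditary M) ↔
        (∀ M : C, Projective M → CSRickart.SelfCSRickart M))) ∧
    (CSRickart.HasFinGenProjectiveGenerators.{w} C →
      ((∀ M : C, CSRickart.FinGen M → Projective M → CSRickart.WeaklySemihereditary M) ↔
        (∀ M : C, CSRickart.FinGen M → Projective M → CSRickart.SelfCSRickart M))) ∧
    (EnoughInjectives C →
      ((∀ M : C, Injective M → CSRickart.WeaklyCohereditary M) ↔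
        (∀ M : C, Injective M → CSRickart.DualSelfCSRickart M))) ∧
    (CSRickart.HasInjectiveHulls C →
      ((∀ M : C, CSRickart.FinCogen M → Injective M → CSRickart.WeaklySemicohereditary M) ↔
        (∀ M : C, CSRickart.FinCogen M → Injective M → CSRickart.DualSelfCSRickart M))) :=
  ⟨fun _ => CSRickart.forall_weaklyHereditary_iff C,
    fun hC => hC.forall_weaklySemihereditary_iff,
    fun _ => CSRickart.forall_weaklyCohereditary_iff C,
    fun hC => hC.forall_weaklySemicohereditary_iff⟩

theorem theoremt {C : Type u} [Category.{v} C] [Abelian C] [IsGrothendieckAbelian.{w} C] :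
    (CSRickart.HasFinGenProjectiveGenerators.{w} C →
      ((∀ M : C, Projective M → CSRickart.WeaklyHereditary M) ↔
        (∀ M : C, Projective M → CSRickart.SelfCSRickart M)) ∧
      ((∀ M : C, CSRickart.FinGen M → Projective M → CSRickart.WeaklySemihereditary M) ↔
        (∀ M : C, CSRickart.FinGen M → Projective M → CSRickart.SelfCSRickart M))) ∧
    (CSRickart.LocallyFinGen.{w} C →
      ((∀ M : C, Injective M → CSRickart.WeaklyCohereditary M) ↔
        (∀ M : C, Injective M → CSRickart.DualSelfCSRickart M)) ∧
      ((∀ M : C, CSRickart.FinCogen M → Injective M → CSRickart.WeaklySemicohereditary M) ↔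
        (∀ M : C, CSRickart.FinCogen M → Injective M → CSRickart.DualSelfCSRickart M))) := by
  obtain ⟨hproj, hproj', hinj, hinj'⟩ := theoremt_general.{w} (C := C)
  exact ⟨fun hC => ⟨hproj hC.enoughProjectives, hproj' hC⟩,
    fun _ => ⟨hinj inferInstance, hinj' (CSRickart.hasInjectiveHulls C)⟩⟩
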